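/- Let $\mathcal{A}$ be a semi-abelian category, that is, a pointed, Barr exact and Bourn protomodular category with binary coproducts. (For a pointed regular category, Bourn protomodularity means that the Regular Short Five Lemma holds: for every commutative square $f\circ b=a\circ f'$ with $f\colon B\to A$ and $f'\colon B'\to A'$ regular epimorphisms, if $a\colon A'\to A$ and the induced map $\mathrm{Ker}(f')\to\mathrm{Ker}(f)$ are isomorphisms, then $b\colon B'\to B$ is an isomorphism.) Suppose that $\mathcal{A}$ has enough regular projectives: every object is the codomain of a regular epimorphism whose domain is projective with respect to regular epimorphisms. A \emph{Birkhoff subcategory} $\mathcal{B}$ of $\mathcal{A}$ is a full reflective subcategory closed under subobjects and regular quotients; write $I$ for the reflector and $\eta$ for its unit. Relative to $\mathcal{B}$: an \emph{extension} is a regular epimorphism; an extension $f\colon B\to A$ is \emph{trivial} if the naturality square $\eta_A\circ f=I(f)\circ\eta_B$ is a pullback; it is \emph{central} if there is an extension $g\colon C\to A$ such that the pullback $g^*(f)$ of $f$ along $g$ is trivial; an object $P$ is \emph{perfect} if $I(P)$ is a zero object. A central extension $u\colon U\to A$ is \emph{weakly universal} if for every central extension $f\colon B\to A$ there is a morphism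 $\overline f\colon U\to B$ with $f\circ\overline f=u$, and \emph{universal} if such an $\overline f$ always exists and is unique. Let $\mathsf{Ab}(\mathcal{A})$ be the Birkhoff subcategory of objects of $\mathcal{A}$ that admit an internal abelian group structure. Suppose that $\mathcal{A}$ satisfies condition (UCE): if $f\colon B\to A$ and $g\colon C\to B$ are $\mathsf{Ab}(\mathcal{A})$-central extensions and $B$ is $\mathsf{Ab}(\mathcal{A})$-perfect, then $f\circ g$ is an $\mathsf{Ab}(\mathcal{A})$-central extension. Let $\mathcal{B}$ be a Birkhoff subcategory of $\mathcal{A}$ that contains $\mathsf{Ab}(\mathcal{A})$, and let $u\colon U\to A$ be a $\mathcal{B}$-central extension. Consider the following conditions: \begin{enumerate} \item $U$ is $\mathcal{B}$-perfect and every $\mathcal{B}$-central extension of $U$ splits; \item $U$ is $\mathcal{B}$-perfect and projective with respect to all $\mathcal{B}$-central extensions; \item for every $\mathcal{B}$-central extension $f\colon X\to Y$, the map $f\circ(-)\colon\hom(U,X)\to\hom(U,Y)$ is a bijection; \item $U$ is $\mathcal{B}$-perfect and $u$ is a weakly universal $\mathcal{B}$-central extension; \item $u$ is a universal $\mathcal{B}$-central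 extension. \end{enumerate} Then condition 4 implies condition 1, and conditions 1--5 are all equivalent; they are also equivalent to condition 3 restricted to the $\mathcal{B}$-central extensions with codomain $Y=A$. Hence a $\mathcal{B}$-central extension $u\colon U\to A$ is universal if and only if its domain $U$ is $\mathcal{B}$-perfect and projective with respect to all $\mathcal{B}$-central extensions. -/

import Mathlib

open CategoryTheory Limits

universe v u

namespace CentralExt

section Basic

variable {C : Type u} [Category.{v} C]

/-- A reflection of `X` into the full subcategory of objects satisfying `P`: a universal arrow from
`X` to an object of the subcategory. It is unique up to a unique isomorphism; if the
subcategory is reflective with left adjoint `I`, this is the unit `X ⟶ I X`. -/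
structure IsReflection (P : ObjectProperty C) {X Y : C} (η : X ⟶ Y) : Prop where
  prop : P Y
  existsUnique_fac : ∀ ⦃Z : C⦄, P Z → ∀ g : X ⟶ Z, ∃! h : Y ⟶ Z, η ≫ h = g

/-- The unit of any left adjoint to the inclusion of the full subcategory is a reflection. -/
theorem isReflection_unit {P : ObjectProperty C} {I : C ⥤ P.FullSubcategory} (adj : I ⊣ P.ι)
    (X : C) : IsReflection P (Y := (I.obj X).obj) (adj.unit.app X) where
  prop := (I.obj X).property
  existsUnique_fac := by
    intro Z hZ g
    refine ⟨P.ι.map ((adj.homEquiv X ⟨Z, hZ⟩).symm g), ?_, ?_⟩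
    · have h := (adj.homEquiv X ⟨Z, hZ⟩).apply_symm_apply g
      rw [Adjunction.homEquiv_unit] at h
      exact h
    · intro h hh
      have key : adj.homEquiv X ⟨Z, hZ⟩ (ObjectProperty.homMk h) = g := by
        rw [Adjunction.homEquiv_unit]
        exact hh
      rw [← key, Equiv.symm_apply_apply]
      rfl

/-- A Birkhoff subcategory: a full reflective subcategory closed under subobjects and
regular quotients (hence also under isomorphisms). -/
structure IsBirkhoff (P : ObjectProperty C) : Prop where
  reflective : P.ι.IsRightAdjoint
  closedUnderSubobjects : ∀ ⦃X Y : C⦄ (m : X ⟶ Y), Mono m → P Y → P X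
  closedUnderRegularQuotients : ∀ ⦃X Y : C⦄ (p : X ⟶ Y), IsRegularEpi p → P X → P Y

/-- A trivial extension relative to `P`: a regular epimorphism `f : B ⟶ A` such that the
naturality square of reflections (with bottom arrow `I f` the unique arrow making it commute)
is a pullback. -/
def IsTrivialExt (P : ObjectProperty C) {B A : C} (f : B ⟶ A) : Prop :=
  IsRegularEpi f ∧
    ∃ (IB IA : C) (ηB : B ⟶ IB) (ηA : A ⟶ IA) (If : IB ⟶ IA),
      IsReflection P ηB ∧ IsReflection P ηA ∧ IsPullback f ηB ηA If

/-- A central extension relative to `P`: a regular epimorphism `f : B ⟶ A` whose pullback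
`g^* f : D ⟶ E` along some regular epimorphism `g : E ⟶ A` is a trivial extension. -/
def IsCentralExt (P : ObjectProperty C) {B A : C} (f : B ⟶ A) : Prop :=
  IsRegularEpi f ∧
    ∃ (E D : C) (g : E ⟶ A) (p : D ⟶ B) (f' : D ⟶ E),
      IsRegularEpi g ∧ IsPullback p f' f g ∧ IsTrivialExt P f'

/-- An object is perfect relative to `P` when its reflection is a zero object. -/
def IsPerfect (P : ObjectProperty C) (X : C) : Prop :=
  ∃ (Y : C) (η : X ⟶ Y), IsReflection P η ∧ IsZero Y

/-- `u` is a weakly initial object among the central extensions of its codomain. -/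
def IsWeaklyUniversalCentralExt (P : ObjectProperty C) {U A : C} (u : U ⟶ A) : Prop :=
  IsCentralExt P u ∧
    ∀ ⦃B : C⦄ (f : B ⟶ A), IsCentralExt P f → ∃ g : U ⟶ B, g ≫ f = u

/-- `u` is an initial object among the central extensions of its codomain. -/
def IsUniversalCentralExt (P : ObjectProperty C) {U A : C} (u : U ⟶ A) : Prop :=
  IsCentralExt P u ∧
    ∀ ⦃B : C⦄ (f : B ⟶ A), IsCentralExt P f → ∃! g : U ⟶ B, g ≫ f = u

/-- `U` is projective with respect to all central extensions. -/
def IsProjectiveForCentralExts (P : ObjectProperty C) (U : C) : Prop :=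
  ∀ ⦃X Y : C⦄ (f : X ⟶ Y), IsCentralExt P f → ∀ g : U ⟶ Y, ∃ h : U ⟶ X, h ≫ f = g

/-- Every central extension of `U` is a split epimorphism. -/
def CentralExtsSplit (P : ObjectProperty C) (U : C) : Prop :=
  ∀ ⦃X : C⦄ (f : X ⟶ U), IsCentralExt P f → IsSplitEpi f

variable (C) in
/-- Enough projectives, in the regular sense: every object is the codomain of a regular epimorphism
whose domain is projective with respect to regular epimorphisms. -/
def EnoughRegularProjectives : Prop :=
  ∀ X : C, ∃ (Q : C) (p : Q ⟶ X), IsRegularEpi p ∧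
    ∀ ⦃Y Z : C⦄ (e : Y ⟶ Z), IsRegularEpi e → ∀ g : Q ⟶ Z, ∃ h : Q ⟶ Y, h ≫ e = g

variable (C) in
/-- The full subcategory `Ab(C)` of objects admitting an internal abelian group structure
(with respect to the cartesian products of `C`). -/
def abelianObjects [HasFiniteProducts C] : ObjectProperty C := fun X =>
  letI := CartesianMonoidalCategory.ofHasFiniteProducts (C := C)
  letI := BraidedCategory.ofCartesianMonoidalCategory (C := C)
  ∃ _ : GrpObj X, IsCommMonObj X

end Basic

section SemiAbelian

variable (C : Type u) [Category.{v} C] [HasZeroMorphisms C]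

/-- A semi-abelian category: pointed, Barr exact (regular, and every internal equivalence relation
is a kernel pair), Bourn protomodular (formulated as the Regular Short Five Lemma), with binary
coproducts. -/
class SemiAbelian : Prop extends Regular C, HasZeroObject C, HasBinaryCoproducts C where
  exact : ∀ ⦃R X : C⦄ (p₁ p₂ : R ⟶ X), IsEquivalenceRelation p₁ p₂ →
    ∃ (Y : C) (f : X ⟶ Y), IsKernelPair f p₁ p₂
  shortFive : ∀ ⦃B' A' B A : C⦄ (f' : B' ⟶ A') (f : B ⟶ A) (b : B' ⟶ B) (a : A' ⟶ A)
    (w : f' ≫ a = b ≫ f), IsRegularEpi f' → IsRegularEpi f →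
    IsIso (kernel.map f' f b a w) → IsIso a → IsIso b

/-- The universal central extension condition. -/
def ConditionUCE [SemiAbelian C] : Prop :=
  ∀ ⦃D B A : C⦄ (g : D ⟶ B) (f : B ⟶ A), IsPerfect (abelianObjects C) B →
    IsCentralExt (abelianObjects C) f → IsCentralExt (abelianObjects C) g → IsCentralExt (abelianObjects C) (g ≫ f)

end SemiAbelian

end CentralExt

open CentralExt

/-! The proof runs on null morphisms, those killed by every map into `P`. An extension is trivial
exactly when its kernel has no nonzero null elements (`isTrivialExt_of_isNull`,
`IsTrivialExt.eq_of_isNull`). Hence central extensions are pullback stable and split ones are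
trivial, so a perfect object has at most one lift along a central extension.

This uniqueness and pullback stability give the passages among splitting, projectivity and
bijectivity. A universal `u` has perfect domain because `A ⨯ Z ⟶ A` is trivial for `Z` in `P`.

The hard step is from weakly universal to splitting. A central `f` over the perfect `U` is first
covered by some `V ⟶ U` with `V` perfect. Perfect domains make this map and `u` central relative to
abelian objects, so (UCE) applies to their composite. As `Ab` lies in `P`, the composite is
`P`-central; weak universality yields a map `U ⟶ V`, and uniqueness of lifts makes it a section over
`U`. -/

namespace CentralExt

attribute [local simp] pullback.lift_fst pullback.lift_snd pullback.lift_fst_assoc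
  pullback.lift_snd_assoc prod.lift_fst prod.lift_snd prod.lift_fst_assoc prod.lift_snd_assoc
  equalizer.lift_ι equalizer.lift_ι_assoc kernel.lift_ι kernel.lift_ι_assoc

/-! ### Regular epimorphisms as covers for generalized elements. -/

section

variable {C : Type u} [Category.{v} C]

theorem isIso_of_mono_of_isRegularEpi {X Y : C} (f : X ⟶ Y) [Mono f] (h : IsRegularEpi f) :
    IsIso f :=
  isIso_of_mono_of_strongEpi f

theorem exists_diagonal_lift {X Y I Z : C} {e : X ⟶ Y} (he : IsRegularEpi e) {m : I ⟶ Z} [Mono m]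
    {x : X ⟶ I} {y : Y ⟶ Z} (w : x ≫ m = e ≫ y) : ∃ l : Y ⟶ I, l ≫ m = y :=
  ⟨(CommSq.mk w).lift, (CommSq.mk w).fac_right⟩

end

section RegularCategory

variable {C : Type u} [Category.{v} C] [Regular C]

theorem isRegularEpi_of_strongEpi {X Y : C} (f : X ⟶ Y) [StrongEpi f] : IsRegularEpi f :=
  inferInstance

theorem isRegularEpi_comp {X Y Z : C} {f : X ⟶ Y} {g : Y ⟶ Z} (hf : IsRegularEpi f)
    (hg : IsRegularEpi g) : IsRegularEpi (f ≫ g) :=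
  have := strongEpi_comp f g
  isRegularEpi_of_strongEpi _

theorem isRegularEpi_of_comp {X Y Z : C} {f : X ⟶ Y} {g : Y ⟶ Z}
    (h : IsRegularEpi (f ≫ g)) : IsRegularEpi g :=
  have := strongEpi_of_strongEpi f g
  isRegularEpi_of_strongEpi _

theorem isRegularEpi_of_comp_eq {X Y Z : C} {f : X ⟶ Y} {g : Y ⟶ Z} {h : X ⟶ Z}
    (hh : IsRegularEpi h) (w : f ≫ g = h) : IsRegularEpi g :=
  isRegularEpi_of_comp (f := f) (w ▸ hh)

theorem isRegularEpi_of_isPullback {W X Y Z : C} {p : W ⟶ X} {f' : W ⟶ Y} {f : X ⟶ Z}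
    {g : Y ⟶ Z} (sq : IsPullback p f' f g) (hf : IsRegularEpi f) : IsRegularEpi f' :=
  Regular.regularEpiIsStableUnderBaseChange.of_isPullback sq hf

theorem exists_regularEpi_mono_factorisation {X Y : C} (f : X ⟶ Y) :
    ∃ (I : C) (e : X ⟶ I) (m : I ⟶ Y), IsRegularEpi e ∧ Mono m ∧ e ≫ m = f :=
  ⟨_, (Regular.strongEpiMonoFactorisation f).e, (Regular.strongEpiMonoFactorisation f).m,
    inferInstance, inferInstance, (Regular.strongEpiMonoFactorisation f).fac⟩

/-- Every generalized element of the codomain of a regular epimorphism lifts after a cover. -/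
theorem exists_cover_lift {T X Y : C} {e : X ⟶ Y} (he : IsRegularEpi e) (t : T ⟶ Y) :
    ∃ (T' : C) (c : T' ⟶ T) (r : T' ⟶ X), IsRegularEpi c ∧ r ≫ e = c ≫ t :=
  ⟨pullback e t, pullback.snd e t, pullback.fst e t,
    isRegularEpi_of_isPullback (IsPullback.of_hasPullback e t) he, pullback.condition⟩

end RegularCategory

/-! ### Consequences of the Short Five Lemma. -/

section Protomodular

variable {C : Type u} [Category.{v} C] [HasZeroMorphisms C] [SemiAbelian C]

/-- The image of `w` contains both the kernel of `p` and a section of `p`, so the Short Five Lemma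
makes it all of `T`. -/
theorem isRegularEpi_of_section_of_kernel {W T X : C} (w : W ⟶ T) (p : T ⟶ X) (s : X ⟶ W)
    (hs : s ≫ w ≫ p = 𝟙 X)
    (hk : ∀ ⦃Z : C⦄ (z : Z ⟶ T), z ≫ p = 0 → ∃ y : Z ⟶ W, y ≫ w = z) : IsRegularEpi w := by
  obtain ⟨I, e, m, he, hm, rfl⟩ := exists_regularEpi_mono_factorisation w
  have h1 : IsSplitEpi (m ≫ p) := IsSplitEpi.mk' ⟨s ≫ e, by simpa using hs⟩
  have h2 : IsSplitEpi p := IsSplitEpi.mk' ⟨s ≫ e ≫ m, by simpa using hs⟩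
  obtain ⟨y, hy⟩ := hk (kernel.ι p) (by simp)
  have hw : (m ≫ p) ≫ 𝟙 X = m ≫ p := by simp
  have : IsIso (kernel.map (m ≫ p) p m (𝟙 X) hw) := by
    refine ⟨kernel.lift _ (y ≫ e) (by rw [Category.assoc, reassoc_of% hy]; simp), ?_, ?_⟩
    · rw [← cancel_mono (kernel.ι _), ← cancel_mono m]
      simp [kernel.map, hy]
    · rw [← cancel_mono (kernel.ι _)]
      simp [kernel.map, hy]
  have := SemiAbelian.shortFive (m ≫ p) p m (𝟙 X) hw inferInstance inferInstance this
    inferInstance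
  exact isRegularEpi_comp he inferInstance

/-- The equalizer of `f` and `g` contains the section and the kernel, so its inclusion is a cover.
-/
theorem hom_ext_of_section_of_kernel {T X Z : C} {p : T ⟶ X} {s : X ⟶ T} (hs : s ≫ p = 𝟙 X)
    {f g : T ⟶ Z} (h : s ≫ f = s ≫ g)
    (hk : ∀ ⦃Y : C⦄ (z : Y ⟶ T), z ≫ p = 0 → z ≫ f = z ≫ g) : f = g := by
  have := isRegularEpi_of_section_of_kernel (equalizer.ι f g) p (equalizer.lift s h) (by simpa)
    (fun Z z hz => ⟨equalizer.lift z (hk z hz), by simp⟩)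
  rw [← cancel_epi (equalizer.ι f g)]
  exact equalizer.condition f g

theorem mono_of_comp_eq_zero {X Y : C} (h : X ⟶ Y)
    (hk : ∀ ⦃T : C⦄ (x : T ⟶ X), x ≫ h = 0 → x = 0) : Mono h := by
  refine (IsKernelPair.of_hasPullback h).mono_of_eq_fst_snd ?_
  refine hom_ext_of_section_of_kernel (p := pullback.fst h h)
    (s := pullback.lift (𝟙 X) (𝟙 X) rfl) (by simp) (by simp) (fun Y z hz => ?_)
  rw [hz, hk (z ≫ pullback.snd h h)]
  rw [Category.assoc, ← pullback.condition, reassoc_of% hz, zero_comp]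

/-- Spans in a semi-abelian category are difunctional, up to a cover. -/
theorem exists_cover_difunctional {R X Y T : C} (r₁ : R ⟶ X) (r₂ : R ⟶ Y) (a b c : T ⟶ R)
    (h₁ : a ≫ r₁ = b ≫ r₁) (h₂ : b ≫ r₂ = c ≫ r₂) :
    ∃ (T' : C) (t : T' ⟶ T) (d : T' ⟶ R), IsRegularEpi t ∧
      d ≫ r₁ = t ≫ c ≫ r₁ ∧ d ≫ r₂ = t ≫ a ≫ r₂ := by
  -- The target of `w` consists of triples `(a, b, c)` as in the statement; `D` adds a solution `d`
  -- and `w` forgets it. Over the section `c = b` one takes `d = a`; over the kernel `a = b = 0` one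
  -- takes `d = c`.
  let k₁ := pullback.fst (pullback.snd r₁ r₁) (pullback.fst r₂ r₂)
  let k₂ := pullback.snd (pullback.snd r₁ r₁) (pullback.fst r₂ r₂)
  let α := k₁ ≫ pullback.fst r₁ r₁
  let γ := k₂ ≫ pullback.snd r₂ r₂
  let D := pullback (prod.lift r₁ r₂) (prod.lift (γ ≫ r₁) (α ≫ r₂))
  let w : D ⟶ _ := pullback.snd (prod.lift r₁ r₂) (prod.lift (γ ≫ r₁) (α ≫ r₂))
  have hw : IsRegularEpi w := by
    let σ : pullback r₁ r₁ ⟶ pullback r₂ r₂ :=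
      pullback.lift (pullback.snd r₁ r₁) (pullback.snd r₁ r₁) rfl
    have hσ : pullback.fst r₁ r₁ ≫ prod.lift r₁ r₂ =
        pullback.lift (𝟙 _) σ (by simp [σ]) ≫ prod.lift (γ ≫ r₁) (α ≫ r₂) := by
      ext <;> simp [α, γ, k₁, k₂, σ, pullback.condition]
    refine isRegularEpi_of_section_of_kernel w k₁ (pullback.lift _ _ hσ) (by simp [w, k₁])
      (fun Z z hz => ?_)
    · have hα : z ≫ α = 0 := by simp only [α, reassoc_of% hz, zero_comp]
      have hγ : z ≫ γ ≫ r₂ = 0 := by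
        simp only [γ, Category.assoc]
        rw [← pullback.condition, show k₂ ≫ pullback.fst r₂ r₂ ≫ r₂ =
          k₁ ≫ pullback.snd r₁ r₁ ≫ r₂ by
            rw [← Category.assoc, ← Category.assoc, pullback.condition], reassoc_of% hz, zero_comp]
      have hz' : (z ≫ γ) ≫ prod.lift r₁ r₂ = z ≫ prod.lift (γ ≫ r₁) (α ≫ r₂) := by
        ext
        · simp
        · simp [hγ, reassoc_of% hα]
      exact ⟨pullback.lift _ _ hz', by simp [w]⟩
  let τ : T ⟶ pullback (pullback.snd r₁ r₁) (pullback.fst r₂ r₂) :=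
    pullback.lift (pullback.lift a b h₁) (pullback.lift b c h₂) (by simp)
  obtain ⟨T', t, r, ht, hr⟩ := exists_cover_lift hw τ
  have h0 : (r ≫ pullback.fst _ _) ≫ prod.lift r₁ r₂ =
      t ≫ τ ≫ prod.lift (γ ≫ r₁) (α ≫ r₂) := by
    rw [← reassoc_of% hr, Category.assoc, pullback.condition]
  refine ⟨T', t, r ≫ pullback.fst _ _, ht, ?_, ?_⟩
  · simpa [τ, γ, k₂] using h0 =≫ prod.fst
  · simpa [τ, α, k₁] using h0 =≫ prod.snd

end Protomodular

/-! ### Null morphisms. -/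

section Null

variable {C : Type u} [Category.{v} C] [HasZeroMorphisms C] {P : ObjectProperty C}

/-- A morphism is `P`-null when it is annihilated by every morphism to an object of `P`. If `P` is
reflective, this says that it factors through the kernel of the reflection of its codomain. -/
def IsNull (P : ObjectProperty C) {T X : C} (x : T ⟶ X) : Prop :=
  ∀ ⦃Z : C⦄, P Z → ∀ m : X ⟶ Z, x ≫ m = 0

theorem IsNull.comp {T X Y : C} {x : T ⟶ X} (hx : IsNull P x) (f : X ⟶ Y) : IsNull P (x ≫ f) :=
  fun Z hZ m => by rw [Category.assoc, hx hZ]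

theorem isNull_of_epi_comp {T' T X : C} {t : T' ⟶ T} [Epi t] {x : T ⟶ X}
    (h : IsNull P (t ≫ x)) : IsNull P x :=
  fun Z hZ m => by
    rw [← cancel_epi t, ← Category.assoc, h hZ, comp_zero]

theorem IsReflection.isNull_iff {X Y T : C} {η : X ⟶ Y} (h : IsReflection P η) (x : T ⟶ X) :
    IsNull P x ↔ x ≫ η = 0 := by
  refine ⟨fun hx => hx h.prop η, fun hx Z hZ m => ?_⟩
  obtain ⟨k, rfl, -⟩ := h.existsUnique_fac hZ m
  rw [reassoc_of% hx, zero_comp]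

theorem isReflection_zero {X O : C} (hX : IsNull P (𝟙 X)) (hO : IsZero O) (hPO : P O) :
    IsReflection P (0 : X ⟶ O) where
  prop := hPO
  existsUnique_fac := fun Z hZ g =>
    ⟨0, by simpa using (hX hZ g).symm, fun _ _ => hO.eq_of_src _ _⟩

theorem IsPerfect.isNull {X : C} (h : IsPerfect P X) : IsNull P (𝟙 X) := by
  obtain ⟨Y, η, hη, hY⟩ := h
  rw [hη.isNull_iff]
  exact hY.eq_of_tgt _ _

theorem isPerfect_of_isNull {X O : C} (hX : IsNull P (𝟙 X)) (hO : IsZero O) (hPO : P O) :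
    IsPerfect P X :=
  ⟨O, 0, isReflection_zero hX hO hPO, hO⟩

theorem IsTrivialExt.eq_of_isNull {B A T : C} {f : B ⟶ A} (hf : IsTrivialExt P f) {x y : T ⟶ B}
    (hx : IsNull P x) (hy : IsNull P y) (h : x ≫ f = y ≫ f) : x = y := by
  obtain ⟨-, IB, IA, ηB, ηA, If, hB, -, sq⟩ := hf
  exact sq.hom_ext h (by rw [hx hB.prop, hy hB.prop])

end Null

/-! ### Trivial and central extensions of a Birkhoff subcategory. -/

section Birkhoff

variable {C : Type u} [Category.{v} C]

theorem IsBirkhoff.exists_reflection {P : ObjectProperty C} (hP : IsBirkhoff P) (X : C) :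
    ∃ (Y : C) (η : X ⟶ Y), IsReflection P η :=
  have := hP.reflective
  ⟨_, _, isReflection_unit (Adjunction.ofIsRightAdjoint P.ι) X⟩

theorem IsReflection.isRegularEpi [Regular C] {P : ObjectProperty C} (hP : IsBirkhoff P) {X Y : C}
    {η : X ⟶ Y} (h : IsReflection P η) : IsRegularEpi η := by
  obtain ⟨I, e, m, he, hm, rfl⟩ := exists_regularEpi_mono_factorisation η
  obtain ⟨k, hk, -⟩ :=
    h.existsUnique_fac (hP.closedUnderSubobjects m hm h.prop) e
  have h1 : k ≫ m = 𝟙 Y := by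
    obtain ⟨l, -, hl⟩ := h.existsUnique_fac h.prop (e ≫ m)
    rw [hl (k ≫ m) (by simp [reassoc_of% hk]), hl (𝟙 Y) (by simp)]
  have : IsSplitEpi m := IsSplitEpi.mk' ⟨k, h1⟩
  exact isRegularEpi_comp he inferInstance

theorem IsTrivialExt.isCentralExt {P : ObjectProperty C} {B A : C} {f : B ⟶ A} (hf : IsTrivialExt P f) :
    IsCentralExt P f :=
  ⟨hf.1, A, B, 𝟙 A, 𝟙 B, f, inferInstance, IsPullback.of_horiz_isIso ⟨by simp⟩, hf⟩

variable [HasZeroMorphisms C] [SemiAbelian C] {P : ObjectProperty C}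

/-- Reflexivity and symmetry descend from the kernel pair. Transitivity is the Mal'tsev argument:
difunctionality applied to `(y, z)`, `(y, y)`, `(x, y)` gives `(x, z)`, after a cover that the mono
`m` removes. -/
theorem isEquivalenceRelation_image {B A R S I : C} {f : B ⟶ A} (hf : IsRegularEpi f) {η : B ⟶ I}
    {p₁ p₂ : R ⟶ B} (hR : IsKernelPair η p₁ p₂) {e : R ⟶ S} (he : IsRegularEpi e)
    {m : S ⟶ A ⨯ A} [Mono m] (w : e ≫ m = prod.lift (p₁ ≫ f) (p₂ ≫ f)) :
    IsEquivalenceRelation (m ≫ prod.fst) (m ≫ prod.snd) := by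
  have ext : ∀ ⦃T : C⦄ (a b : T ⟶ S), a ≫ m ≫ prod.fst = b ≫ m ≫ prod.fst →
      a ≫ m ≫ prod.snd = b ≫ m ≫ prod.snd → a = b := fun T a b h₁ h₂ => by
    rw [← cancel_mono m]
    ext <;> simpa
  have w₁ : e ≫ m ≫ prod.fst = p₁ ≫ f := by rw [reassoc_of% w]; simp
  have w₂ : e ≫ m ≫ prod.snd = p₂ ≫ f := by rw [reassoc_of% w]; simp
  obtain ⟨ρ, hρ⟩ := exists_diagonal_lift hf (m := m) (x := hR.lift (𝟙 B) (𝟙 B) rfl ≫ e)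
    (y := prod.lift (𝟙 A) (𝟙 A)) (by ext <;> simp [w])
  obtain ⟨σ, hσ⟩ := exists_diagonal_lift he (m := m) (x := hR.lift p₂ p₁ hR.w.symm ≫ e)
    (y := prod.lift (m ≫ prod.snd) (m ≫ prod.fst)) (by ext <;> simp [w, w₁, w₂])
  have hρ₁ : ρ ≫ m ≫ prod.fst = 𝟙 A := by rw [reassoc_of% hρ]; simp
  have hρ₂ : ρ ≫ m ≫ prod.snd = 𝟙 A := by rw [reassoc_of% hρ]; simp
  let a := pullback.fst (m ≫ prod.snd) (m ≫ prod.fst)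
  let b := pullback.snd (m ≫ prod.snd) (m ≫ prod.fst)
  have hab : a ≫ m ≫ prod.snd = b ≫ m ≫ prod.fst := pullback.condition
  obtain ⟨T, t, d, ht, hd₁, hd₂⟩ := exists_cover_difunctional (m ≫ prod.fst) (m ≫ prod.snd)
    b (a ≫ m ≫ prod.snd ≫ ρ) a (by simp [hρ₁, hab]) (by simp [hρ₂])
  obtain ⟨τ, hτ⟩ := exists_diagonal_lift ht (m := m) (x := d)
    (y := prod.lift (a ≫ m ≫ prod.fst) (b ≫ m ≫ prod.snd)) (by ext <;> simp [hd₁, hd₂])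
  exact ⟨⟨{
    right_cancellation := ext
    r := ρ
    reflexivity₁ := hρ₁
    reflexivity₂ := hρ₂
    s := σ
    symmetry₁ := by rw [reassoc_of% hσ]; simp
    symmetry₂ := by rw [reassoc_of% hσ]; simp
    c := _
    isLimit := pullback.isLimit _ _
    t := τ
    transitivity₁ := by rw [reassoc_of% hτ]; simp [a]
    transitivity₂ := by rw [reassoc_of% hτ]; simp [b] }⟩⟩

/-- Null morphisms lift along regular epimorphisms, up to a cover: the kernel of the reflection
preserves regular epimorphisms. -/
theorem exists_cover_isNull_lift (hP : IsBirkhoff P) {B A T : C} {f : B ⟶ A} (hf : IsRegularEpi f)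
    {l : T ⟶ A} (hl : IsNull P l) :
    ∃ (T' : C) (t : T' ⟶ T) (x : T' ⟶ B), IsRegularEpi t ∧ IsNull P x ∧ x ≫ f = t ≫ l := by
  obtain ⟨I, η, hη⟩ := hP.exists_reflection B
  have hηe := hη.isRegularEpi hP
  let p₁ := pullback.fst η η
  let p₂ := pullback.snd η η
  have hR : IsKernelPair η p₁ p₂ := IsKernelPair.of_hasPullback η
  obtain ⟨S, e, m, he, hm, w⟩ := exists_regularEpi_mono_factorisation
    (prod.lift (p₁ ≫ f) (p₂ ≫ f))
  have w₁ : e ≫ m ≫ prod.fst = p₁ ≫ f := by rw [reassoc_of% w]; simp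
  have w₂ : e ≫ m ≫ prod.snd = p₂ ≫ f := by rw [reassoc_of% w]; simp
  obtain ⟨Q₀, q₀, hq₀⟩ := SemiAbelian.exact _ _ (isEquivalenceRelation_image hf hR he w)
  -- Exactness only supplies some map with kernel pair `S`; its image is a regular quotient of `A`,
  -- and also of `I`, so it lies in `P` and kills `l`. Thus `(0, l)` belongs to `S`.
  obtain ⟨Q, q, n, hq, hn, rfl⟩ := exists_regularEpi_mono_factorisation q₀
  have hqs : (m ≫ prod.fst) ≫ q = (m ≫ prod.snd) ≫ q := by
    rw [← cancel_mono n]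
    simpa using hq₀.w
  obtain ⟨g, hg⟩ := IsRegularEpi.exists_of_isKernelPair η hR (f ≫ q) (by
    rw [← reassoc_of% w₁, ← reassoc_of% w₂]
    simpa using e ≫= hqs)
  have hPQ : P Q := hP.closedUnderRegularQuotients g
    (isRegularEpi_of_comp_eq (isRegularEpi_comp hf hq) hg) hη.prop
  have hlq : l ≫ q = 0 := hl hPQ q
  let k : T ⟶ S := hq₀.lift 0 l (by rw [reassoc_of% hlq]; simp)
  have hk₁ : k ≫ m ≫ prod.fst = 0 := hq₀.lift_fst _ _ _
  have hk₂ : k ≫ m ≫ prod.snd = l := hq₀.lift_snd _ _ _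
  obtain ⟨T₁, t₁, r, ht₁, hr⟩ := exists_cover_lift he k
  have hrf : r ≫ p₁ ≫ f = 0 := by rw [← w₁, reassoc_of% hr, hk₁, comp_zero]
  let b : T₁ ⟶ pullback η η := hR.lift (r ≫ p₁) (r ≫ p₁) rfl
  have hb₁ : b ≫ p₁ = r ≫ p₁ := hR.lift_fst _ _ _
  have hb₂ : b ≫ p₂ = r ≫ p₁ := hR.lift_snd _ _ _
  have hbe : b ≫ e = 0 := by
    rw [← cancel_mono m]
    ext
    · simp [w₁, reassoc_of% hb₁, hrf]
    · simp [w₂, reassoc_of% hb₂, hrf]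
  -- With `r = (r₁, r₂)` and `b = (r₁, r₁)`, difunctionality replaces subtraction of `b`: it gives
  -- `d = (0, x)` with the same image in `S` as `r`. Being congruent to zero modulo `η`, `x` is
  -- null.
  obtain ⟨T₂, t₂, d, ht₂, hd₁, hd₂⟩ := exists_cover_difunctional p₁ e r b 0 hb₁.symm
    (by rw [hbe, zero_comp])
  refine ⟨T₂, t₂ ≫ t₁, d ≫ p₂, isRegularEpi_comp ht₂ ht₁, ?_, ?_⟩
  · rw [hη.isNull_iff, Category.assoc, ← hR.w, reassoc_of% hd₁]
    simp
  · rw [Category.assoc, ← w₂, reassoc_of% hd₂, reassoc_of% hr, hk₂, Category.assoc]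

/-- Compare `B` with the pullback over `IB`. On kernels the comparison is mono by `h` and a cover by
`exists_cover_isNull_lift`; the Short Five Lemma concludes. -/
theorem isTrivialExt_of_isNull (hP : IsBirkhoff P) {B A : C} {f : B ⟶ A} (hf : IsRegularEpi f)
    (h : ∀ ⦃T : C⦄ (x : T ⟶ B), IsNull P x → x ≫ f = 0 → x = 0) : IsTrivialExt P f := by
  obtain ⟨IB, ηB, hB⟩ := hP.exists_reflection B
  obtain ⟨IA, ηA, hA⟩ := hP.exists_reflection A
  obtain ⟨If, hIf, -⟩ := hB.existsUnique_fac hA.prop (f ≫ ηA)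
  refine ⟨hf, IB, IA, ηB, ηA, If, hB, hA, ?_⟩
  let c : B ⟶ pullback ηA If := pullback.lift f ηB hIf.symm
  have hc₁ : c ≫ pullback.fst ηA If = f := pullback.lift_fst _ _ _
  have hc₂ : c ≫ pullback.snd ηA If = ηB := pullback.lift_snd _ _ _
  have hw : ηB ≫ 𝟙 IB = c ≫ pullback.snd ηA If := by rw [hc₂, Category.comp_id]
  have hsnd : IsRegularEpi (pullback.snd ηA If) :=
    isRegularEpi_of_isPullback (IsPullback.of_hasPullback ηA If) (hA.isRegularEpi hP)
  let κ := kernel.map ηB (pullback.snd ηA If) c (𝟙 IB) hw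
  have hκ : κ ≫ kernel.ι _ = kernel.ι ηB ≫ c := kernel.lift_ι _ _ _
  have hmono : Mono κ := mono_of_comp_eq_zero κ fun T x hx => by
    have h0 : x ≫ kernel.ι ηB ≫ c = 0 := by rw [← hκ, reassoc_of% hx, zero_comp]
    rw [← cancel_mono (kernel.ι ηB), zero_comp]
    refine h _ ((hB.isNull_iff _).2 (by simp)) ?_
    rw [← hc₁, Category.assoc, reassoc_of% h0, zero_comp]
  have hepi : IsRegularEpi κ := by
    obtain ⟨T', t, x, ht, hx, hxt⟩ := exists_cover_isNull_lift hP hf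
      (l := kernel.ι (pullback.snd ηA If) ≫ pullback.fst ηA If)
      ((hA.isNull_iff _).2 (by rw [Category.assoc, pullback.condition, kernel.condition_assoc,
        zero_comp]))
    refine isRegularEpi_of_comp_eq ht (f := kernel.lift ηB x ((hB.isNull_iff _).1 hx)) ?_
    rw [← cancel_mono (kernel.ι _), Category.assoc, hκ, kernel.lift_ι_assoc]
    apply pullback.hom_ext
    · rw [Category.assoc, hc₁, hxt, Category.assoc]
    · rw [Category.assoc, hc₂, (hB.isNull_iff _).1 hx, Category.assoc, kernel.condition, comp_zero]
  have := SemiAbelian.shortFive ηB (pullback.snd ηA If) c (𝟙 IB) hw (hB.isRegularEpi hP) hsnd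
    (isIso_of_mono_of_isRegularEpi κ hepi) inferInstance
  exact IsPullback.of_iso_pullback ⟨hIf.symm⟩ (asIso c) hc₁ hc₂

theorem isCentralExt_of_isPullback (hP : IsBirkhoff P) {B' B A' A : C} {p : B' ⟶ B} {f' : B' ⟶ A'}
    {f : B ⟶ A} {h : A' ⟶ A} (sq : IsPullback p f' f h) (hf : IsCentralExt P f) :
    IsCentralExt P f' := by
  obtain ⟨hf, E, D, g, q, k, hg, sq', hk⟩ := hf
  have hf' := isRegularEpi_of_isPullback sq hf
  have hg' : IsRegularEpi (pullback.fst h g) :=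
    isRegularEpi_of_isPullback (IsPullback.of_hasPullback h g).flip hg
  refine ⟨hf', pullback h g, pullback f' (pullback.fst h g), pullback.fst h g,
    pullback.fst _ _, pullback.snd _ _, hg', IsPullback.of_hasPullback _ _, ?_⟩
  refine isTrivialExt_of_isNull hP
    (isRegularEpi_of_isPullback (IsPullback.of_hasPullback f' (pullback.fst h g)) hf') ?_
  intro T x hx hx0
  let ψ : pullback f' (pullback.fst h g) ⟶ D :=
    sq'.lift (pullback.fst _ _ ≫ p) (pullback.snd _ _ ≫ pullback.snd h g) (by
      rw [Category.assoc, sq.w, pullback.condition_assoc, pullback.condition, Category.assoc])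
  have hψ₁ : ψ ≫ q = pullback.fst _ _ ≫ p := sq'.lift_fst _ _ _
  have hψ₂ : ψ ≫ k = pullback.snd _ _ ≫ pullback.snd h g := sq'.lift_snd _ _ _
  have hxψ : x ≫ ψ = 0 := by
    refine hk.eq_of_isNull (hx.comp ψ) (fun _ _ _ => zero_comp) ?_
    rw [Category.assoc, hψ₂, reassoc_of% hx0, zero_comp, zero_comp]
  apply pullback.hom_ext
  · apply sq.hom_ext
    · rw [Category.assoc, ← hψ₁, reassoc_of% hxψ]
      simp
    · rw [Category.assoc, pullback.condition, reassoc_of% hx0]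
      simp
  · rw [hx0, zero_comp]

/-- Split central extensions are trivial. -/
theorem IsCentralExt.isTrivialExt_of_section (hP : IsBirkhoff P) {B A : C} {f : B ⟶ A}
    (hf : IsCentralExt P f) {s : A ⟶ B} (hs : s ≫ f = 𝟙 A) : IsTrivialExt P f := by
  obtain ⟨hf, E, D, g, p, f', hg, sq, hf'⟩ := hf
  refine isTrivialExt_of_isNull hP hf fun T x hx hx0 => ?_
  obtain ⟨T', t, y, ht, hy, hyx⟩ := exists_cover_isNull_lift hP
    (isRegularEpi_of_isPullback sq.flip hg) hx
  let s' : E ⟶ D := sq.lift (g ≫ s) (𝟙 E) (by rw [Category.assoc, hs]; simp)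
  have hs'₁ : s' ≫ p = g ≫ s := sq.lift_fst _ _ _
  have hs'₂ : s' ≫ f' = 𝟙 E := sq.lift_snd _ _ _
  -- Both sides are null with the same image under the trivial `f'`.
  have hyy : y = y ≫ f' ≫ s' :=
    hf'.eq_of_isNull hy (hy.comp _) (by simp [hs'₂])
  rw [← cancel_epi t, ← hyx, hyy, Category.assoc, Category.assoc, hs'₁, ← reassoc_of% sq.w,
    reassoc_of% hyx, reassoc_of% hx0]
  simp

/-- Morphisms from a perfect object to the domain of a central extension are determined by
their composites with the extension. -/
theorem IsCentralExt.eq_of_isNull_id (hP : IsBirkhoff P) {X Y U : C} {f : X ⟶ Y}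
    (hf : IsCentralExt P f) (hU : IsNull P (𝟙 U)) {a b : U ⟶ X} (h : a ≫ f = b ≫ f) : a = b := by
  -- Pulling back along `a ≫ f` gives `f` the section induced by `a`, so the pullback is trivial.
  have sq := IsPullback.of_hasPullback f (a ≫ f)
  have ht := (isCentralExt_of_isPullback hP sq hf).isTrivialExt_of_section hP
    (s := pullback.lift a (𝟙 U) (by simp)) (by simp)
  have hnull : ∀ {W : C} (w : U ⟶ W), IsNull P w := fun w => by
    simpa using hU.comp w
  have key := ht.eq_of_isNull (hnull (pullback.lift a (𝟙 U) (by simp)))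
    (hnull (pullback.lift b (𝟙 U) (by simp [h]))) (by simp)
  simpa using key =≫ pullback.fst f (a ≫ f)

theorem isTrivialExt_prod_fst (hP : IsBirkhoff P) (A : C) {Z : C} (hZ : P Z) :
    IsTrivialExt P (prod.fst : A ⨯ Z ⟶ A) := by
  have : IsSplitEpi (prod.fst : A ⨯ Z ⟶ A) :=
    IsSplitEpi.mk' ⟨prod.lift (𝟙 A) 0, prod.lift_fst _ _⟩
  refine isTrivialExt_of_isNull hP inferInstance fun T x hx hx0 => ?_
  ext
  · simpa using hx0
  · simpa using hx hZ prod.snd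

/-- A central extension of a perfect object is covered by one with perfect domain. -/
theorem IsCentralExt.exists_perfect_cover (hP : IsBirkhoff P) {X U : C} {f : X ⟶ U}
    (hf : IsCentralExt P f) (hU : IsNull P (𝟙 U)) :
    ∃ (V : C) (i : V ⟶ X), IsNull P (𝟙 V) ∧ IsCentralExt P (i ≫ f) := by
  obtain ⟨I, η, hη⟩ := hP.exists_reflection X
  let i := kernel.ι η
  have hi : IsNull P i := (hη.isNull_iff _).2 (kernel.condition η)
  have hv : IsRegularEpi (i ≫ f) := by
    obtain ⟨T, t, x, ht, hx, hxt⟩ := exists_cover_isNull_lift hP hf.1 hU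
    refine isRegularEpi_of_comp_eq (f := kernel.lift η x ((hη.isNull_iff _).1 hx)) ht ?_
    simp [i, hxt]
  have sq := IsPullback.of_hasPullback f (i ≫ f)
  let s : kernel η ⟶ pullback f (i ≫ f) := pullback.lift i (𝟙 _) (by simp)
  have hs₁ : s ≫ pullback.fst f (i ≫ f) = i := pullback.lift_fst _ _ _
  have hs₂ : s ≫ pullback.snd f (i ≫ f) = 𝟙 _ := pullback.lift_snd _ _ _
  have htr := (isCentralExt_of_isPullback hP sq hf).isTrivialExt_of_section hP hs₂
  refine ⟨kernel η, i, ?_, hv, ?_⟩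
  · obtain ⟨T, t, y, ht, hy, hyt⟩ :=
      exists_cover_isNull_lift hP (isRegularEpi_of_isPullback sq.flip hv) hi
    have hyy : y = y ≫ pullback.snd f (i ≫ f) ≫ s :=
      htr.eq_of_isNull hy (hy.comp _) (by simp [hs₂])
    -- The cover `t` factors through the null `y`, hence is null itself; cancelling it makes the
    -- identity of the kernel null.
    have ht' : y ≫ pullback.snd f (i ≫ f) = t := by
      rw [← cancel_mono i, ← hyt]
      conv_rhs => rw [hyy]
      simp [hs₁]
    have : IsNull P (t ≫ 𝟙 _) := by
      rw [Category.comp_id, ← ht']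
      exact hy.comp _
    exact isNull_of_epi_comp this
  · refine ⟨_, _, i ≫ f, pullback.fst _ _, pullback.snd _ _, hv,
      IsPullback.of_hasPullback (i ≫ f) (i ≫ f), ?_⟩
    refine isTrivialExt_of_isNull hP
      (isRegularEpi_of_isPullback (IsPullback.of_hasPullback (i ≫ f) (i ≫ f)) hv) ?_
    intro T x hx hx0
    let j : pullback (i ≫ f) (i ≫ f) ⟶ pullback f (i ≫ f) :=
      pullback.lift (pullback.fst _ _ ≫ i) (pullback.snd _ _) (by
        rw [Category.assoc, pullback.condition])
    have hxj : x ≫ j = 0 := htr.eq_of_isNull (hx.comp j) (fun _ _ _ => zero_comp) (by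
      simp [j, hx0])
    apply pullback.hom_ext
    · rw [← cancel_mono i]
      simpa [j] using hxj =≫ pullback.fst f (i ≫ f)
    · rw [hx0, zero_comp]

end Birkhoff

/-! ### Abelian objects and the comparison of the two notions of centrality. -/

section AbelianObjects

open MonoidalCategory CartesianMonoidalCategory in
theorem exists_grpObj_isCommMonObj {C : Type u} [Category.{v} C] [CartesianMonoidalCategory C]
    [BraidedCategory C] {K : C} (e : 𝟙_ C ⟶ K) (μ : K ⊗ K ⟶ K) (ν : K ⟶ K)
    (hone : lift (toUnit K ≫ e) (𝟙 K) ≫ μ = 𝟙 K)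
    (hcomm : lift (snd K K) (fst K K) ≫ μ = μ)
    (hassoc : ∀ ⦃T : C⦄ (x y z : T ⟶ K),
      lift (lift x y ≫ μ) z ≫ μ = lift x (lift y z ≫ μ) ≫ μ)
    (hinv : lift (𝟙 K) ν ≫ μ = toUnit K ≫ e) :
    ∃ _ : GrpObj K, IsCommMonObj K := by
  have hcomm' : ∀ ⦃T : C⦄ (x y : T ⟶ K), lift x y ≫ μ = lift y x ≫ μ := fun T x y => by
    conv_lhs => rw [← hcomm]
    rw [← Category.assoc]
    congr 1
    ext <;> simp
  refine ⟨{ toMonObj := { one := e, mul := μ, one_mul := ?_, mul_one := ?_, mul_assoc := ?_ },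
            inv := ν, left_inv := ?_, right_inv := hinv },
    @IsCommMonObj.mk _ _ _ _ _ (_) ?_⟩
  · have h : e ▷ K = (λ_ K).hom ≫ lift (toUnit K ≫ e) (𝟙 K) := by
      ext
      · simp only [whiskerRight_fst, Category.assoc, lift_fst]
        rw [← Category.assoc (λ_ K).hom]
        congr 1
        exact toUnit_unique _ _
      · simp [leftUnitor_hom]
    rw [h, Category.assoc, hone, Category.comp_id]
  · have h : K ◁ e = (ρ_ K).hom ≫ lift (𝟙 K) (toUnit K ≫ e) := by
      ext
      · simp [rightUnitor_hom]
      · simp only [whiskerLeft_snd, Category.assoc, lift_snd]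
        rw [← Category.assoc (ρ_ K).hom]
        congr 1
        exact toUnit_unique _ _
    rw [h, Category.assoc, hcomm', hone, Category.comp_id]
  · have h := hassoc (fst (K ⊗ K) K ≫ fst K K) (fst (K ⊗ K) K ≫ snd K K) (snd (K ⊗ K) K)
    have h₁ : lift (fst (K ⊗ K) K ≫ fst K K) (fst (K ⊗ K) K ≫ snd K K) = fst (K ⊗ K) K := by
      ext <;> simp
    rw [h₁] at h
    convert h using 1
    · congr 1
      ext <;> simp
    · rw [← Category.assoc]
      congr 1
      ext
      · simp
      · simp only [Category.assoc, whiskerLeft_snd, lift_snd]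
        rw [← Category.assoc]
        congr 1
        ext <;> simp
  · rw [hcomm', hinv]
  · have h : (β_ K K).hom = lift (snd K K) (fst K K) := by ext <;> simp
    rw [h]
    exact hcomm

variable {C : Type u} [Category.{v} C] [HasZeroMorphisms C]

theorem abelianObjects_of_isZero [HasFiniteProducts C] {O : C} (hO : IsZero O) :
    abelianObjects C O := by
  let := CartesianMonoidalCategory.ofHasFiniteProducts (C := C)
  let := BraidedCategory.ofCartesianMonoidalCategory (C := C)
  exact exists_grpObj_isCommMonObj 0 0 0 (hO.eq_of_tgt _ _) (hO.eq_of_tgt _ _)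
    (fun _ _ _ _ => hO.eq_of_tgt _ _) (hO.eq_of_tgt _ _)

variable [SemiAbelian C]

/-- The inclusion of `Y` is the kernel of `prod.fst`, which the inclusion of `X` splits. -/
theorem prod_hom_ext_of_inl_inr {X Y Z : C} {f g : X ⨯ Y ⟶ Z}
    (h₁ : prod.lift (𝟙 X) 0 ≫ f = prod.lift (𝟙 X) 0 ≫ g)
    (h₂ : prod.lift 0 (𝟙 Y) ≫ f = prod.lift 0 (𝟙 Y) ≫ g) : f = g := by
  refine hom_ext_of_section_of_kernel (prod.lift_fst (𝟙 X) 0) h₁ fun T z hz => ?_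
  have : z = (z ≫ prod.snd) ≫ prod.lift 0 (𝟙 Y) := by ext <;> simp [hz]
  rw [this, Category.assoc, h₂, ← Category.assoc]

/-- In a semi-abelian category a unital magma with inverses is an internal abelian group. -/
theorem abelianObjects_of_unital {K : C} (μ : K ⨯ K ⟶ K) (h₁ : prod.lift (𝟙 K) 0 ≫ μ = 𝟙 K)
    (h₂ : prod.lift 0 (𝟙 K) ≫ μ = 𝟙 K) (ν : K ⟶ K) (hν : prod.lift (𝟙 K) ν ≫ μ = 0) :
    abelianObjects C K := by
  have hcomm : prod.lift prod.snd prod.fst ≫ μ = μ := by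
    apply prod_hom_ext_of_inl_inr
    · rw [h₁, ← Category.assoc, prod.comp_lift]
      simpa using h₂
    · rw [h₂, ← Category.assoc, prod.comp_lift]
      simpa using h₁
  have hr : ∀ ⦃T : C⦄ (x : T ⟶ K), prod.lift x 0 ≫ μ = x := fun T x => by
    simpa [prod.comp_lift_assoc] using x ≫= h₁
  have hl : ∀ ⦃T : C⦄ (x : T ⟶ K), prod.lift 0 x ≫ μ = x := fun T x => by
    simpa [prod.comp_lift_assoc] using x ≫= h₂
  have hassoc₀ : prod.lift (prod.lift prod.fst (prod.snd ≫ prod.fst) ≫ μ)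
      ((prod.snd : K ⨯ K ⨯ K ⟶ K ⨯ K) ≫ prod.snd) ≫ μ = prod.lift prod.fst (prod.snd ≫ μ) ≫ μ := by
    apply prod_hom_ext_of_inl_inr
    · simp [prod.comp_lift_assoc, hr]
    · simp [prod.comp_lift_assoc, hl]
  have hassoc : ∀ ⦃T : C⦄ (x y z : T ⟶ K),
      prod.lift (prod.lift x y ≫ μ) z ≫ μ = prod.lift x (prod.lift y z ≫ μ) ≫ μ :=
    fun T x y z => by
      simpa [prod.comp_lift_assoc] using prod.lift x (prod.lift y z) ≫= hassoc₀
  let := CartesianMonoidalCategory.ofHasFiniteProducts (C := C)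
  let := BraidedCategory.ofCartesianMonoidalCategory (C := C)
  have hlift : ∀ ⦃T : C⦄ (x y : T ⟶ K), CartesianMonoidalCategory.lift x y ≫
      prod.lift (CartesianMonoidalCategory.fst K K) (CartesianMonoidalCategory.snd K K) ≫ μ =
      prod.lift x y ≫ μ := fun T x y => by
    simp [prod.comp_lift_assoc]
  refine exists_grpObj_isCommMonObj 0
    (prod.lift (CartesianMonoidalCategory.fst K K) (CartesianMonoidalCategory.snd K K) ≫ μ) ν
    ?_ ?_ ?_ ?_
  · rw [hlift, comp_zero, h₂]
  · rw [hlift]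
    conv_rhs => rw [← hcomm]
    simp [prod.comp_lift_assoc]
  · intro T x y z
    simp only [hlift]
    exact hassoc x y z
  · rw [hlift, hν, comp_zero]

/-- A central extension with perfect domain is central with respect to the abelian objects. -/
theorem IsCentralExt.isCentralExt_abelianObjects {P : ObjectProperty C} (hP : IsBirkhoff P)
    (hAb : abelianObjects C ≤ P) {V U : C} {f : V ⟶ U} (hf : IsCentralExt P f)
    (hV : IsNull P (𝟙 V)) : IsCentralExt (abelianObjects C) f := by
  have sq := IsPullback.of_hasPullback f f
  let p₁ := pullback.fst f f
  let p₂ := pullback.snd f f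
  let δ : V ⟶ pullback f f := pullback.lift (𝟙 V) (𝟙 V) rfl
  have hδ₁ : δ ≫ p₁ = 𝟙 V := pullback.lift_fst _ _ _
  have hδ₂ : δ ≫ p₂ = 𝟙 V := pullback.lift_snd _ _ _
  have hp₁ : IsTrivialExt P p₁ :=
    (isCentralExt_of_isPullback hP sq.flip hf).isTrivialExt_of_section hP hδ₁
  obtain ⟨hp₁e, K, IV, ηR, ηV, If, hηR, hηV, hsq⟩ := hp₁
  have hVnull : ∀ {W : C} (w : V ⟶ W), IsNull P w := fun w => by simpa using hV.comp w
  have hηV0 : ηV = 0 := hVnull (𝟙 V) hηV.prop ηV ▸ (Category.id_comp ηV).symm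
  have := hηR.isRegularEpi hP
  have hIf : If = 0 := by
    rw [← cancel_epi ηR, ← hsq.w, hηV0, comp_zero, comp_zero]
  -- As `V` is perfect, the trivialising square exhibits the kernel pair of `f` as `V × K`. The
  -- composite `ι ≫ p₂` below is then a kernel of `f`.
  have hfac : ∀ ⦃T : C⦄ (x : T ⟶ V) (k : T ⟶ K),
      ∃ r : T ⟶ pullback f f, r ≫ p₁ = x ∧ r ≫ ηR = k := fun T x k => by
    have h : x ≫ ηV = k ≫ If := by rw [hηV0, hIf, comp_zero, comp_zero]
    exact ⟨hsq.lift x k h, hsq.lift_fst _ _ _, hsq.lift_snd _ _ _⟩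
  have hw : p₁ ≫ f = p₂ ≫ f := pullback.condition
  have hδη : δ ≫ ηR = 0 := hVnull δ hηR.prop ηR
  obtain ⟨ι, hι₁, hιη⟩ := hfac 0 (𝟙 K)
  have hιf : ι ≫ p₂ ≫ f = 0 := by rw [← hw, reassoc_of% hι₁, zero_comp]
  have hker : ∀ ⦃T : C⦄ (z : T ⟶ V), z ≫ f = 0 → ∃ k : T ⟶ K, k ≫ ι ≫ p₂ = z := fun T z hz => by
    let ζ : T ⟶ pullback f f := pullback.lift 0 z (by rw [hz, zero_comp])
    refine ⟨ζ ≫ ηR, ?_⟩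
    have : (ζ ≫ ηR) ≫ ι = ζ := hsq.hom_ext (by
      rw [Category.assoc, hι₁, comp_zero]
      exact (pullback.lift_fst _ _ _).symm) (by rw [Category.assoc, hιη, Category.comp_id])
    rw [← Category.assoc, this]
    exact pullback.lift_snd _ _ _
  have hmono : Mono (ι ≫ p₂) := mono_of_comp_eq_zero _ fun T x hx => by
    have : x ≫ ι = 0 := by
      apply sq.hom_ext
      · rw [Category.assoc, hι₁, comp_zero, zero_comp]
      · rw [Category.assoc, hx, zero_comp]
    rw [← Category.comp_id x, ← hιη, reassoc_of% this, zero_comp]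
  -- In `V × K` coordinates, `K` acts on `V` through `p₂`; restricting the action to the kernel of
  -- `f` gives `μ`. The diagonal has zero `K`-coordinate, whence a unit law, and the pair `(k, 0)`
  -- supplies the inverse of `k`.
  obtain ⟨φ, hφ₁, hφη⟩ := hfac ((prod.fst : K ⨯ K ⟶ K) ≫ ι ≫ p₂) prod.snd
  obtain ⟨μ, hμ⟩ := hker (φ ≫ p₂) (by
    rw [Category.assoc, ← hw, reassoc_of% hφ₁, hιf, comp_zero])
  have hK : abelianObjects C K := by
    let ξ : K ⟶ pullback f f := pullback.lift (ι ≫ p₂) 0 (by rw [Category.assoc, hιf, zero_comp])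
    refine abelianObjects_of_unital μ ?_ ?_ (ξ ≫ ηR) ?_
    · have : prod.lift (𝟙 K) 0 ≫ φ = ι ≫ p₂ ≫ δ := hsq.hom_ext
        (by simp [hφ₁, hδ₁]) (by simp [hφη, hδη])
      rw [← cancel_mono (ι ≫ p₂), Category.assoc, hμ, reassoc_of% this, hδ₂]
      simp
    · have : prod.lift 0 (𝟙 K) ≫ φ = ι := hsq.hom_ext
        (by simp [hφ₁, hι₁]) (by simp [hφη, hιη])
      rw [← cancel_mono (ι ≫ p₂), Category.assoc, hμ, reassoc_of% this]
      simp
    · have : prod.lift (𝟙 K) (ξ ≫ ηR) ≫ φ = ξ := hsq.hom_ext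
        (by simp [hφ₁, ξ, p₁]) (by simp [hφη])
      rw [← cancel_mono (ι ≫ p₂), Category.assoc, hμ, reassoc_of% this, zero_comp]
      exact pullback.lift_snd _ _ _
  obtain ⟨O, hO⟩ := HasZeroObject.zero (C := C)
  refine ⟨hf.1, V, pullback f f, f, p₂, p₁, hf.1, sq.flip, hp₁e, K, O, ηR, 0, 0,
    ⟨hK, fun Z hZ g => ⟨ι ≫ g, ?_, fun h hh => ?_⟩⟩,
    isReflection_zero (fun Z hZ => hV (hAb Z hZ)) hO (abelianObjects_of_isZero hO), ?_⟩
  -- A map to an abelian object vanishes on the diagonal, since `V` is perfect, so it is determined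
  -- by its restriction along `ι`.
  · refine hom_ext_of_section_of_kernel hδ₁ ?_ fun T z hz => ?_
    · rw [reassoc_of% hδη, zero_comp]
      exact (hVnull δ (hAb Z hZ) g).symm
    · have : (z ≫ ηR) ≫ ι = z := hsq.hom_ext (by
        rw [Category.assoc, hι₁, comp_zero, hz]) (by rw [Category.assoc, hιη, Category.comp_id])
      simpa using this =≫ g
  · rw [← hh, reassoc_of% hιη]
  · refine ⟨⟨by simp⟩, ⟨PullbackCone.IsLimit.mk _ (fun c => hsq.lift c.fst c.snd ?_) ?_ ?_ ?_⟩⟩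
    · rw [hηV0, hIf, comp_zero, comp_zero]
    · exact fun c => hsq.lift_fst _ _ _
    · exact fun c => hsq.lift_snd _ _ _
    · exact fun c m h₁ h₂ => hsq.hom_ext (by rw [h₁, hsq.lift_fst]) (by rw [h₂, hsq.lift_snd])

/-- A larger `P` has fewer null morphisms, so the same cover trivialises `f`. -/
theorem IsCentralExt.of_abelianObjects {P : ObjectProperty C} (hP : IsBirkhoff P)
    (hAb : abelianObjects C ≤ P) {B A : C} {f : B ⟶ A} (hf : IsCentralExt (abelianObjects C) f) :
    IsCentralExt P f := by
  obtain ⟨hf, E, D, g, p, f', hg, sq, hf'⟩ := hf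
  exact ⟨hf, E, D, g, p, f', hg, sq, isTrivialExt_of_isNull hP hf'.1 fun T x hx hx0 =>
    hf'.eq_of_isNull (fun Z hZ => hx (hAb Z hZ)) (fun _ _ _ => zero_comp) (by rw [hx0, zero_comp])⟩

end AbelianObjects

/-! ### Universal central extensions. -/

section Universal

variable {C : Type u} [Category.{v} C] [HasZeroMorphisms C] [SemiAbelian C] {P : ObjectProperty C}

theorem CentralExtsSplit.isProjectiveForCentralExts (hP : IsBirkhoff P) {U : C}
    (h : CentralExtsSplit P U) : IsProjectiveForCentralExts P U := by
  intro X Y f hf g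
  obtain ⟨⟨s⟩⟩ := h _ (isCentralExt_of_isPullback hP (IsPullback.of_hasPullback f g) hf)
  exact ⟨s.section_ ≫ pullback.fst f g, by
    rw [Category.assoc, pullback.condition, s.id_assoc]⟩

theorem IsUniversalCentralExt.isPerfect (hP : IsBirkhoff P) {U A : C} {u : U ⟶ A}
    (hu : IsUniversalCentralExt P u) : IsPerfect P U := by
  obtain ⟨I, η, hη⟩ := hP.exists_reflection U
  have h0 : η = 0 := by
    obtain ⟨g, -, hg⟩ := hu.2 _ (isTrivialExt_prod_fst hP A hη.prop).isCentralExt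
    -- Two lifts of `u` along `A ⨯ I ⟶ A` must agree, which forces `η = 0`.
    have := (hg (prod.lift u η) (by simp)).trans (hg (prod.lift u 0) (by simp)).symm
    simpa using this =≫ prod.snd
  refine ⟨I, η, hη, (IsZero.iff_id_eq_zero I).2 ?_⟩
  have := hη.isRegularEpi hP
  rw [← cancel_epi η, h0, zero_comp, zero_comp]

theorem IsWeaklyUniversalCentralExt.centralExtsSplit (hUCE : ConditionUCE C) (hP : IsBirkhoff P)
    (hAb : abelianObjects C ≤ P) {U A : C} {u : U ⟶ A} (hU : IsNull P (𝟙 U))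
    (hu : IsWeaklyUniversalCentralExt P u) : CentralExtsSplit P U := by
  intro X f hf
  obtain ⟨V, i, hV, hv⟩ := hf.exists_perfect_cover hP hU
  obtain ⟨O, hO⟩ := HasZeroObject.zero (C := C)
  have hUperf : IsPerfect (abelianObjects C) U :=
    isPerfect_of_isNull (fun Z hZ => hU (hAb Z hZ)) hO (abelianObjects_of_isZero hO)
  have huv := (hUCE (i ≫ f) u hUperf (hu.1.isCentralExt_abelianObjects hP hAb hU)
    (hv.isCentralExt_abelianObjects hP hAb hV)).of_abelianObjects hP hAb
  obtain ⟨g, hg⟩ := hu.2 _ huv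
  -- Both `g ≫ i ≫ f` and the identity lift `u` along itself, so they coincide.
  refine IsSplitEpi.mk' ⟨g ≫ i, hu.1.eq_of_isNull_id hP hU ?_⟩
  simpa using hg

end Universal

end CentralExt

theorem mainTheorem4 {C : Type u} [Category.{v} C] [HasZeroMorphisms C] [SemiAbelian C]
    (hproj : EnoughRegularProjectives C) (hUCE : ConditionUCE C)
    (P : ObjectProperty C) (hP : IsBirkhoff P) (hAb : abelianObjects C ≤ P)
    {U A : C} (u : U ⟶ A) (hu : IsCentralExt P u) :
    (IsPerfect P U ∧ IsWeaklyUniversalCentralExt P u → IsPerfect P U ∧ CentralExtsSplit P U) ∧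
    List.TFAE [
      IsPerfect P U ∧ CentralExtsSplit P U,
      IsPerfect P U ∧ IsProjectiveForCentralExts P U,
      ∀ ⦃X Y : C⦄ (f : X ⟶ Y), IsCentralExt P f →
        Function.Bijective (fun h : U ⟶ X => h ≫ f),
      ∀ ⦃B : C⦄ (f : B ⟶ A), IsCentralExt P f →
        Function.Bijective (fun h : U ⟶ B => h ≫ f),
      IsPerfect P U ∧ IsWeaklyUniversalCentralExt P u,
      IsUniversalCentralExt P u] ∧
    (IsUniversalCentralExt P u ↔ IsPerfect P U ∧ IsProjectiveForCentralExts P U) := by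
  have h51 : IsPerfect P U ∧ IsWeaklyUniversalCentralExt P u →
      IsPerfect P U ∧ CentralExtsSplit P U :=
    fun h => ⟨h.1, h.2.centralExtsSplit hUCE hP hAb h.1.isNull⟩
  have tfae : List.TFAE [
      IsPerfect P U ∧ CentralExtsSplit P U,
      IsPerfect P U ∧ IsProjectiveForCentralExts P U,
      ∀ ⦃X Y : C⦄ (f : X ⟶ Y), IsCentralExt P f →
        Function.Bijective (fun h : U ⟶ X => h ≫ f),
      ∀ ⦃B : C⦄ (f : B ⟶ A), IsCentralExt P f →
        Function.Bijective (fun h : U ⟶ B => h ≫ f),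
      IsPerfect P U ∧ IsWeaklyUniversalCentralExt P u,
      IsUniversalCentralExt P u] := by
    tfae_have 1 → 2 := fun h => ⟨h.1, h.2.isProjectiveForCentralExts hP⟩
    tfae_have 2 → 3 := fun h X Y f hf =>
      ⟨fun _ _ hab => hf.eq_of_isNull_id hP h.1.isNull hab, h.2 f hf⟩
    tfae_have 3 → 4 := fun h B f hf => h f hf
    tfae_have 4 → 6 := fun h => ⟨hu, fun B f hf => (h f hf).existsUnique u⟩
    tfae_have 6 → 5 := fun h => ⟨h.isPerfect hP, hu, fun B f hf => (h.2 f hf).exists⟩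
    tfae_have 5 → 1 := h51
    tfae_finish
  exact ⟨h51, tfae, tfae.out 5 1⟩
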